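/- **Setting.** Let $\mathcal G$ be a finite knowledge graph with entities $\mathcal V$, relations $\mathcal R$ and facts $r(u,v)$; put $\mathcal N_r(v)=\{w : r(w,v) \text{ is a fact}\}$. Let $d\ge 2$, let $\mathbf r_q\in\mathbb R^d\setminus\{0\}$ be the vector of the query relation, and for each head entity $h$ let $x_{u|h}\in\mathbb R^d$ $(u\in\mathcal V)$ be the input representations of the layer. *Query and value functions.* Both are stacks of layers $$z_u\;\mapsto\;\Phi\Big(\alpha\odot z_u+\sum_{r(v,u)}z_v\odot\hat{\mathbf r}\Big),\qquad \hat{\mathbf r}=W_r\mathbf r_q+b_r,$$ with $\Phi$ a three-layer ReLU network and parameters $\alpha,W_r,b_r,\Phi$ (with free widths) depending on the layer. The query function starts from $[x_{u|h},\epsilon_u]$ with random features $\epsilon_u\in\mathbb R^k$, and the value function from $[x_{u|h},\mathbf 1_{u=h}\mathbf r_q]$. Let $\tilde z_u$ and $\bar z_u$ denote their outputs. *Attention layer.* With $\kappa(z,z')=1+\big\langle \tfrac{zW_1}{\|zW_1\|},\tfrac{z'W_2}{\|z'W_2\|}\big\rangle$ (biases included, a zero vector being left as it is) and $\alpha_{uv}=\kappa(\tilde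 z_u,\tilde z_v)/\sum_w\kappa(\tilde z_u,\tilde z_w)$ (read as $0$ if the denominator is $0$), the layer maps $u$ to $$\mathrm{LN}_2\Big(\mathrm{FFN}\Big(\mathrm{LN}_1\Big(|\mathcal V|\,\bar z_u+\sum_{v}\alpha_{uv}\bar z_v+x_{u|h}\Big)\Big)\Big),$$ where $\mathrm{FFN}$ is a two-layer ReLU network and $\mathrm{LN}_i$ are layer normalizations with a fixed positive stabilizing constant. Each of these functions, for varying $h$, is a function of the pair $(h,u)$. *The test.* For a pairwise coloring $\eta$ of $\mathcal V\times\mathcal V$, $\mathrm{RA\text{-}WL}_2$ is given by $\mathrm{RA\text{-}WL}_2^{(0)}=\eta$ and $$\mathrm{RA\text{-}WL}_2^{(t+1)}(u,v)=\tau\big(\mathrm{RA\text{-}WL}_2^{(t)}(u,v),\{\!\{(\mathrm{RA\text{-}WL}_2^{(t)}(u,w),r): w\in\mathcal N_r(v),\,r\in\mathcal R\}\!\}\big)$$ with $\tau$ injective into fresh colors. Call $\eta$ *target node distinguishable* if $\eta(u,u)\ne\eta(u,v)$ for $u\neq v$. Two functions on pairs are *equivalent* if they distinguish the same pairs of pairs.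 **Theorem.** Let $\eta$ be any pairwise coloring equivalent to the initialization $(h,u)\mapsto[x_{u|h},\mathbf 1_{u=h}\mathbf r_q]$ of the value function. 1. Query and value functions are conditional message-passing networks of the same depth, that is, of the form $h_u^{(t+1)}=\mathrm{Upd}\big(h_u^{(t)},\mathrm{Agg}\{\!\{\mathrm{Msg}_r(h_v^{(t)},\mathbf r_q): v\in\mathcal N_r(u),\,r\in\mathcal R\}\!\},\mathrm{Read}\{\!\{h_w^{(t)}:w\in\mathcal V\}\!\}\big)$. 2. $\eta$ and the initialization of the value function are target node distinguishable. If the random features are independent standard Gaussian, then for every $h$ and all $u\ne v$ the probability that $u$ and $v$ have the same query initialization tends to $0$ as $k\to\infty$, and the probability that the query initialization of $h$ differs from that of every other entity tends to $1$. 3. The value function with $L$ layers never distinguishes pairs that $\mathrm{RA\text{-}WL}_2^{(L)}$ started from $\eta$ does not distinguish; and for all $T\ge 0$ and every output dimension $\ge1$ some value function with $T+1$ layers is equivalent to $\mathrm{RA\text{-}WL}_2^{(T)}$ started from $\eta$. The same holds, for every value of the random features, for the query function and the test started from the initialization of the query function. 4. For every countable $\mathcal Z\subset\mathbb R^m$,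 $N\ge0$ and $p\ge1$ there are $f:\mathcal Z\to\mathbb R^p$ and $\zeta\in\mathbb R$ such that $(c,X)\mapsto(1+\zeta)f(c)+\sum_{z\in X}f(z)$ is injective on pairs of an element $c$ of $\mathcal Z$ and a multiset $X$ of at most $N$ elements of $\mathcal Z$; and for every finite $S\subset\mathcal Z$ there are two-layer ReLU networks $F$, $g$ with $F=f$ on $S$ such that $(c,X)\mapsto g\big((1+\zeta)F(c)+\sum_{z\in X}F(z)\big)$ is injective on the pairs formed from $S$. In particular, for all query and value functions, projections and random features there are such $F,g,\zeta$ for which this update, applied to the value and the multiset of weighted values $(\bar z_u,\{\!\{\alpha_{uv}\bar z_v: v\in\mathcal V\}\!\})$, is equivalent to that pair, as functions of $(h,u)$. 5. The attention layer can be as expressive as $\mathrm{RA\text{-}WL}_2$: for all $k,T\ge0$ there are parameters of the layer, the same for all values of the random features in $\mathbb R^k$, for which its output is equivalent to $\mathrm{RA\text{-}WL}_2^{(T)}$ started from $\eta$. Moreover, for every prescribed query function with projections $W_1,W_2$ and biases, and every value of the random features, the remaining parameters can be chosen so that the output is equivalent to $\mathrm{RA\text{-}WL}_2^{(T)}$ started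 from $\eta$. -/

import Mathlib

open Filter Topology MeasureTheory ProbabilityTheory

/-- Real feature vectors of dimension `n`. -/
abbrev Vec (n : ℕ) : Type := Fin n → ℝ

/-- A knowledge graph with entities `V` and relations `R`: `G.fact r u v` says that the
fact `r(u,v)` belongs to the set of facts. -/
structure KnowledgeGraph (V R : Type*) where
  fact : R → V → V → Prop

section PairColorings

variable {V α β : Type*}

/-- Two functions on ordered pairs of entities distinguish exactly the same pairs. -/
def SamePartition (f : V → V → α) (g : V → V → β) : Prop :=
  ∀ h u h' u', f h u = f h' u' ↔ g h u = g h' u'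

/-- Every two pairs that are distinguished by `g` are distinguished by `f`. -/
def Refines (f : V → V → α) (g : V → V → β) : Prop :=
  ∀ h u h' u', f h u = f h' u' → g h u = g h' u'

/-- Target node distinguishability of a pairwise coloring. -/
def TargetNodeDistinguishable (η : V → V → α) : Prop :=
  ∀ u v, u ≠ v → η u u ≠ η u v

end PairColorings

section Neighborhoods

variable {V R : Type*} [Fintype V] [Fintype R]

open Classical in
/-- The pairs `(w, r)` with `w ∈ N_r(v)`, that is, with `r(w,v)` a fact. -/
noncomputable def KnowledgeGraph.incoming (G : KnowledgeGraph V R) (v : V) : Finset (V × R) :=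
  Finset.univ.filter fun p => G.fact p.2 p.1 v

end Neighborhoods

/-! The relational asymmetric local 2-WL test. -/

/-- The colors available after `t` rounds. The map `τ` that sends a pair (old color, multiset)
injectively to a fresh color is realized by the pair itself, in a new copy of the
color space for each round. -/
def RAColor.{u, v} (D : Type u) (R : Type v) : ℕ → Type (max u v)
  | 0 => ULift.{v} D
  | t + 1 => RAColor D R t × Multiset (RAColor D R t × R)

/-- The coloring of the pairs of entities after `t` rounds of the test, started from the pairwise
coloring `η`. The neighborhoods are those of the second entity of the pair. -/
noncomputable def rawl {V R D : Type*} [Fintype V] [Fintype R] (G : KnowledgeGraph V R)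
    (η : V → V → D) : (t : ℕ) → V → V → RAColor D R t
  | 0 => fun u v => ULift.up (η u v)
  | t + 1 => fun u v =>
      (rawl G η t u v, (G.incoming v).val.map fun p => (rawl G η t u p.1, p.2))

/-! Feed-forward networks. -/

/-- Coordinatewise ReLU. -/
noncomputable def relu {n : ℕ} (x : Vec n) : Vec n := fun i => max (x i) 0

/-- A two-layer ReLU network (the feed-forward module of the attention layer). -/
structure FFN (a b : ℕ) where
  width : ℕ
  W₁ : Matrix (Fin width) (Fin a) ℝ
  b₁ : Vec width
  W₂ : Matrix (Fin b) (Fin width) ℝ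
  b₂ : Vec b

noncomputable def FFN.eval {a b : ℕ} (F : FFN a b) (x : Vec a) : Vec b :=
  F.W₂.mulVec (relu (F.W₁.mulVec x + F.b₁)) + F.b₂

/-- A three-layer ReLU network (the update functions of the query and value functions). -/
structure MLP (a b : ℕ) where
  width₁ : ℕ
  width₂ : ℕ
  W₁ : Matrix (Fin width₁) (Fin a) ℝ
  b₁ : Vec width₁
  W₂ : Matrix (Fin width₂) (Fin width₁) ℝ
  b₂ : Vec width₂
  W₃ : Matrix (Fin b) (Fin width₂) ℝ
  b₃ : Vec b

noncomputable def MLP.eval {a b : ℕ} (M : MLP a b) (x : Vec a) : Vec b :=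
  M.W₃.mulVec (relu (M.W₂.mulVec (relu (M.W₁.mulVec x + M.b₁)) + M.b₂)) + M.b₃

/-- Layer normalization with stabilizing constant `δ`. -/
structure LayerNorm (d : ℕ) where
  scale : Vec d
  shift : Vec d

noncomputable def LayerNorm.eval {d : ℕ} (N : LayerNorm d) (δ : ℝ) (x : Vec d) : Vec d :=
  let mean : ℝ := (∑ i, x i) / d
  let var : ℝ := (∑ i, (x i - mean) ^ 2) / d
  fun i => N.scale i * ((x i - mean) / √(var + δ)) + N.shift i

/-! Conditional message-passing neural networks. The query `(e_h, r_q, ?)` enters through the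
vector of the query relation and through the initial representation
`u ↦ Init(u | e_h, r_q)`. -/

/-- One layer: relation-specific messages, aggregation of a multiset of messages, global readout
and update. Here `p` is the dimension of the vector of the query relation. -/
structure CMPNNLayer (R : Type*) (p a b : ℕ) where
  msgDim : ℕ
  aggDim : ℕ
  readDim : ℕ
  msg : R → Vec a → Vec p → Vec msgDim
  agg : Multiset (Vec msgDim) → Vec aggDim
  read : Multiset (Vec a) → Vec readDim
  upd : Vec a → Vec aggDim → Vec readDim → Vec b

noncomputable def CMPNNLayer.apply {V R : Type*} [Fintype V] [Fintype R] {p a b : ℕ}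
    (L : CMPNNLayer R p a b) (G : KnowledgeGraph V R) (rq : Vec p) (z : V → Vec a) :
    V → Vec b := fun u =>
  L.upd (z u) (L.agg ((G.incoming u).val.map fun e => L.msg e.2 (z e.1) rq))
    (L.read ((Finset.univ : Finset V).val.map z))

/-- A finite stack of layers. -/
inductive CMPNN (R : Type*) (p : ℕ) : ℕ → ℕ → Type _
  | nil (a : ℕ) : CMPNN R p a a
  | snoc {a b c : ℕ} (C : CMPNN R p a b) (L : CMPNNLayer R p b c) : CMPNN R p a c

def CMPNN.depth {R : Type*} {p : ℕ} : {a b : ℕ} → CMPNN R p a b → ℕ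
  | _, _, .nil _ => 0
  | _, _, .snoc C _ => C.depth + 1

noncomputable def CMPNN.run {V R : Type*} [Fintype V] [Fintype R] {p : ℕ}
    (G : KnowledgeGraph V R) (rq : Vec p) :
    {a b : ℕ} → CMPNN R p a b → (V → Vec a) → V → Vec b
  | _, _, .nil _, z => z
  | _, _, .snoc C L, z => L.apply G rq (CMPNN.run G rq C z)

/-! The structure-aware query and value functions. -/

/-- The parameters of one layer of the query function or of the value function. -/
structure StructLayer (R : Type*) (p a b : ℕ) where
  alpha : Vec a
  W : R → Matrix (Fin a) (Fin p) ℝ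
  bias : R → Vec a
  upd : MLP a b

/-- The vector of the relation `r` in the messages, conditioned on the query relation. -/
noncomputable def StructLayer.relVec {R : Type*} {p a b : ℕ} (L : StructLayer R p a b)
    (rq : Vec p) (r : R) : Vec a := (L.W r).mulVec rq + L.bias r

/-- `z_u ↦ Φ(α ⊙ z_u + ∑_{r(v,u)} z_v ⊙ r̂)`. -/
noncomputable def StructLayer.apply {V R : Type*} [Fintype V] [Fintype R] {p a b : ℕ}
    (L : StructLayer R p a b) (G : KnowledgeGraph V R) (rq : Vec p) (z : V → Vec a) :
    V → Vec b := fun u =>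
  L.upd.eval (L.alpha * z u + ∑ e ∈ G.incoming u, z e.1 * L.relVec rq e.2)

/-- The parameters of a query function or of a value function: a finite stack of layers. -/
inductive StructNet (R : Type*) (p : ℕ) : ℕ → ℕ → Type _
  | nil (a : ℕ) : StructNet R p a a
  | snoc {a b c : ℕ} (S : StructNet R p a b) (L : StructLayer R p b c) : StructNet R p a c

def StructNet.depth {R : Type*} {p : ℕ} : {a b : ℕ} → StructNet R p a b → ℕ
  | _, _, .nil _ => 0
  | _, _, .snoc S _ => S.depth + 1

noncomputable def StructNet.run {V R : Type*} [Fintype V] [Fintype R] {p : ℕ}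
    (G : KnowledgeGraph V R) (rq : Vec p) :
    {a b : ℕ} → StructNet R p a b → (V → Vec a) → V → Vec b
  | _, _, .nil _, z => z
  | _, _, .snoc S L, z => L.apply G rq (StructNet.run G rq S z)

section Initialization

variable {V : Type*} {d k : ℕ}

/-- Initialization of the query function for a fixed head entity: `[x_u, ε_u]`. -/
def queryInit (x : V → Vec d) (ε : V → Vec k) : V → Vec (d + k) :=
  fun u => Fin.append (x u) (ε u)

/-- Initialization of the value function for the head entity `h`: `[x_u, 1_{u = h} r_q]`. -/
noncomputable def valueInit [DecidableEq V] (rq : Vec d) (h : V) (x : V → Vec d) :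
    V → Vec (d + d) :=
  fun u => Fin.append (x u) (if u = h then rq else 0)

/-- The law of independent standard Gaussian features of dimension `k` on all entities. -/
noncomputable def gaussianFeatures (V : Type*) [Fintype V] (k : ℕ) : Measure (V → Vec k) :=
  Measure.pi fun _ => Measure.pi fun _ => gaussianReal 0 1

end Initialization

/-! The attention layer. -/

/-- The Frobenius norm of a row vector. -/
noncomputable def l2norm {n : ℕ} (x : Vec n) : ℝ := √(∑ i, x i ^ 2)

/-- The parameters that determine the attention scores: query function and projections. -/
structure ScoreParams (R : Type*) (d k : ℕ) where
  qdim : ℕ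
  query : StructNet R d (d + k) qdim
  kdim : ℕ
  W₁ : Matrix (Fin kdim) (Fin qdim) ℝ
  b₁ : Vec kdim
  W₂ : Matrix (Fin kdim) (Fin qdim) ℝ
  b₂ : Vec kdim

/-- The remaining parameters: value function, normalization layers, feed-forward module. -/
structure OutParams (R : Type*) (d : ℕ) where
  value : StructNet R d (d + d) d
  norm₁ : LayerNorm d
  ffn : FFN d d
  norm₂ : LayerNorm d

/-- `κ(z, z') = 1 + ⟨zW₁/‖zW₁‖, z'W₂/‖z'W₂‖⟩` (biases included; a zero vector stays zero). -/
noncomputable def ScoreParams.kernel {R : Type*} {d k : ℕ} (Q : ScoreParams R d k)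
    (z z' : Vec Q.qdim) : ℝ :=
  let a := Q.W₁.mulVec z + Q.b₁
  let b := Q.W₂.mulVec z' + Q.b₂
  1 + dotProduct ((l2norm a)⁻¹ • a) ((l2norm b)⁻¹ • b)

section Attention

variable {V R : Type*} [Fintype V] [Fintype R]

/-- The attention score `α_{uv} = κ(z_u, z_v) / ∑_w κ(z_u, z_w)`, where `z` is the output of
the query function. -/
noncomputable def ScoreParams.score {d k : ℕ} (Q : ScoreParams R d k) (G : KnowledgeGraph V R)
    (rq : Vec d) (x : V → Vec d) (ε : V → Vec k) (u v : V) : ℝ :=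
  let z := Q.query.run G rq (queryInit x ε)
  Q.kernel (z u) (z v) / ∑ w, Q.kernel (z u) (z w)

/-- The multiset of weighted values `α_{uv} z̄_v`. -/
noncomputable def ScoreParams.weighted {d k m : ℕ} (Q : ScoreParams R d k)
    (G : KnowledgeGraph V R) (rq : Vec d) (x : V → Vec d) (ε : V → Vec k) (zbar : V → Vec m)
    (u : V) : Multiset (Vec m) :=
  (Finset.univ : Finset V).val.map fun v => Q.score G rq x ε u v • zbar v

/-- The attention function `|V| z̄_u + ∑_v α_{uv} z̄_v`. -/
noncomputable def ScoreParams.attention {d k m : ℕ} (Q : ScoreParams R d k)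
    (G : KnowledgeGraph V R) (rq : Vec d) (x : V → Vec d) (ε : V → Vec k) (zbar : V → Vec m)
    (u : V) : Vec m :=
  (Fintype.card V : ℝ) • zbar u + (Q.weighted G rq x ε zbar u).sum

variable [DecidableEq V]

/-- The output at the entity `u` of the attention layer for a query with head entity `h` and query
relation vector `rq`, on the input representations `x` and the random features `ε`: attention
function, skip connection, normalization, feed-forward module, normalization. -/
noncomputable def attentionLayer {d k : ℕ} (Q : ScoreParams R d k) (P : OutParams R d)
    (G : KnowledgeGraph V R) (δ : ℝ) (rq : Vec d) (h : V) (x : V → Vec d) (ε : V → Vec k)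
    (u : V) : Vec d :=
  P.norm₂.eval δ (P.ffn.eval (P.norm₁.eval δ
    (Q.attention G rq x ε (P.value.run G rq (valueInit rq h x)) u + x u)))

end Attention

/-- The update `g((1 + ζ) f(c) + ∑_{z ∈ X} f(z))` of a vector `c` and a multiset `X`. -/
noncomputable def multisetUpdate {m p n : ℕ} (g : Vec p → Vec n) (f : Vec m → Vec p) (ζ : ℝ)
    (c : Vec m) (X : Multiset (Vec m)) : Vec n :=
  g ((1 + ζ) • f c + (X.map f).sum)

/-- Injectivity on the pairs (element of `Z`, multiset of at most `N` elements of `Z`). -/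
def InjectiveUpdateOn {m n : ℕ} (F : Vec m → Multiset (Vec m) → Vec n) (Z : Set (Vec m))
    (N : ℕ) : Prop :=
  ∀ c ∈ Z, ∀ c' ∈ Z, ∀ X X' : Multiset (Vec m), (∀ z ∈ X, z ∈ Z) → (∀ z ∈ X', z ∈ Z) →
    X.card ≤ N → X'.card ≤ N → F c X = F c' X' → c = c' ∧ X = X'

/-!
One layer of a query or value function sees, at an entity, its old vector and the multiset of incoming
vectors with their relations. This is what one round of the test records, so a network with `L`
layers never separates more than `L` rounds do (`StructNet.refines_run`); it is also why the layers
are message-passing layers.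

For the converse, only finitely many vectors ever occur, and ReLU networks interpolate arbitrary
functions on finite sets: project to a line that separates the points and use hat functions
(`FFN.exists_interpolation`). It remains to keep the sums formed by the layers injective. A color is
represented by a power of a large base `B`, and the relation vectors shift exponents, so that the sum
over the incoming facts has the recorded multiset as its base-`B` digits
(`Multiset.eq_of_sum_pow_code_eq`, `StructNet.exists_run_eq`). The first layer is spent on passing
from the initialization to this representation. The same digits give injective updates
`(1 + ζ) f(c) + ∑ f(z)`: with `1 + ζ = N + 1` the digit of `c` is the only one above `N`
(`exists_injectiveUpdateOn`).

In the attention layer the scores may reveal more than the test does, so their contribution has to be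
dominated and then erased. The scores are nonnegative with sum at most one, so in
`|V| z̄_u + ∑_v α_{uv} z̄_v` the own value has the largest coefficient. If the value of a color is a
power `t ^ m` with its own exponent, this expression is a polynomial in `t` that determines the color
of `(h, u)`, and hence its value at a generic `t` does (`exists_separating_parameter`). Layer
normalization with a positive stabilizing constant forgets only the mean
(`LayerNorm.sub_eq_sub_of_eval_eq`), which is why values on one coordinate axis of a space of
dimension at least two survive it. The feed-forward network then maps all vectors of one color to one
point (`exists_outParams_samePartition`). With vanishing projections all scores are equal, so the
parameters do not depend on the random features.

Random features of dimension at least one differ almost surely on distinct entities, since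
independent Gaussian variables agree with probability zero (`gaussianFeatures_eq_null`); the two
probabilities are therefore exactly `0` and `1` from `k = 1` on.
-/

/-! ### Comparing functions on pairs -/

section Partitions

variable {V α β γ : Type*}

theorem samePartition_iff_refines {f : V → V → α} {g : V → V → β} :
    SamePartition f g ↔ Refines f g ∧ Refines g f :=
  ⟨fun H => ⟨fun h u h' u' => (H h u h' u').1, fun h u h' u' => (H h u h' u').2⟩,
    fun H h u h' u' => ⟨H.1 h u h' u', H.2 h u h' u'⟩⟩

theorem Refines.exists_factor [Nonempty β] {f : V → V → α} {g : V → V → β} (H : Refines f g) :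
    ∃ φ : α → β, ∀ h u, g h u = φ (f h u) := by
  have hf : Function.FactorsThrough (Function.uncurry g) (Function.uncurry f) :=
    fun a b hab => H a.1 a.2 b.1 b.2 hab
  exact ⟨Function.extend (Function.uncurry f) (Function.uncurry g) fun _ => Classical.arbitrary β,
    fun h u => (hf.extend_apply _ (h, u)).symm⟩

/-- A coloring of the pairs of a finite type has finitely many colors, so they can be numbered. -/
theorem exists_code [Finite V] (c : V → V → α) :
    ∃ code : α → ℕ, Set.InjOn code (Set.range (Function.uncurry c)) :=
  Set.countable_iff_exists_injOn.1 (Set.finite_range _).countable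

end Partitions

/-! ### Query and value functions as conditional message passing -/

section MessagePassing

variable {V R D : Type*} {p a b : ℕ}

/-- A layer of the query or value function as a conditional message-passing layer: messages are
multiplied by the relation vector and summed, and the global readout is the empty vector. -/
noncomputable def StructLayer.toCMPNNLayer (L : StructLayer R p a b) : CMPNNLayer R p a b where
  msgDim := a
  aggDim := a
  readDim := 0
  msg r z q := z * L.relVec q r
  agg := Multiset.sum
  read _ := 0
  upd z m _ := L.upd.eval (L.alpha * z + m)

/-- The layerwise translation of a query or value function into a conditional message-passing
network. -/
noncomputable def StructNet.toCMPNN : {a b : ℕ} → StructNet R p a b → CMPNN R p a b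
  | _, _, .nil a => .nil a
  | _, _, .snoc S L => .snoc S.toCMPNN L.toCMPNNLayer

theorem StructNet.depth_toCMPNN (S : StructNet R p a b) : S.toCMPNN.depth = S.depth := by
  induction S with
  | nil => simp only [StructNet.toCMPNN, CMPNN.depth, StructNet.depth]
  | snoc S L ih => simp only [StructNet.toCMPNN, CMPNN.depth, StructNet.depth, ih]

variable [Fintype V] [Fintype R]

theorem StructNet.run_toCMPNN (S : StructNet R p a b) (G : KnowledgeGraph V R) (rq : Vec p)
    (z : V → Vec a) : S.toCMPNN.run G rq z = S.run G rq z := by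
  induction S with
  | nil => simp only [StructNet.toCMPNN, CMPNN.run, StructNet.run]
  | snoc S L ih =>
    simp only [StructNet.toCMPNN, CMPNN.run, StructNet.run, ih]
    rfl

/-- A layer sees only the old vector of `u` and the multiset of the incoming vectors with their
relations, which is what one round of the test records. -/
theorem StructNet.refines_run (G : KnowledgeGraph V R) (rq : Vec p) (η : V → V → D)
    (S : StructNet R p a b) (I : V → V → Vec a) (hI : Refines η I) (n : ℕ) (hn : S.depth = n) :
    Refines (rawl G η n) (fun h => S.run G rq (I h)) := by
  induction S generalizing n with
  | nil =>
    simp only [StructNet.depth] at hn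
    subst hn
    intro h u h' u' e
    simp only [StructNet.run]
    exact hI h u h' u' (congrArg ULift.down e)
  | snoc S L ih =>
    simp only [StructNet.depth] at hn
    subst hn
    intro h u h' u' e
    obtain ⟨φ, hφ⟩ := (ih S.depth rfl).exists_factor
    have e1 : rawl G η S.depth h u = rawl G η S.depth h' u' := congrArg Prod.fst e
    have e2 : (G.incoming u).val.map (fun q => (rawl G η S.depth h q.1, q.2)) =
        (G.incoming u').val.map (fun q => (rawl G η S.depth h' q.1, q.2)) := congrArg Prod.snd e
    have sum_eq : ∀ h u, ∑ q ∈ G.incoming u, S.run G rq (I h) q.1 * L.relVec rq q.2 =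
        (((G.incoming u).val.map (fun q => (rawl G η S.depth h q.1, q.2))).map
          (fun q => φ q.1 * L.relVec rq q.2)).sum := by
      intro h u
      rw [Multiset.map_map]
      refine Finset.sum_congr rfl fun q _ => ?_
      rw [hφ h q.1]
      rfl
    simp only [StructNet.run]
    change L.upd.eval (L.alpha * S.run G rq (I h) u +
        ∑ q ∈ G.incoming u, S.run G rq (I h) q.1 * L.relVec rq q.2) =
      L.upd.eval (L.alpha * S.run G rq (I h') u' +
        ∑ q ∈ G.incoming u', S.run G rq (I h') q.1 * L.relVec rq q.2)
    rw [sum_eq, sum_eq, e2, hφ h u, hφ h' u', e1]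

end MessagePassing

/-! ### Multisets encoded by digits -/

section Digits

theorem digits_eq_of_sum_eq {B : ℕ} (M : ℕ) (a b : ℕ → ℕ) (ha : ∀ n, a n < B) (hb : ∀ n, b n < B)
    (h : ∑ n ∈ Finset.range M, a n * B ^ n = ∑ n ∈ Finset.range M, b n * B ^ n) :
    ∀ n < M, a n = b n := by
  induction M generalizing a b with
  | zero => exact fun n hn => absurd hn (Nat.not_lt_zero n)
  | succ M ih =>
    have split : ∀ c : ℕ → ℕ, ∑ n ∈ Finset.range (M + 1), c n * B ^ n =
        c 0 + B * ∑ n ∈ Finset.range M, c (n + 1) * B ^ n := by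
      intro c
      rw [Finset.sum_range_succ', Finset.mul_sum, add_comm]
      congr 1
      · simp
      · exact Finset.sum_congr rfl fun n _ => by ring
    rw [split, split] at h
    have hB : 0 < B := (Nat.zero_le _).trans_lt (ha 0)
    have h0 : a 0 = b 0 := by
      have := congrArg (· % B) h
      simpa [Nat.add_mul_mod_self_left, Nat.mod_eq_of_lt (ha 0), Nat.mod_eq_of_lt (hb 0)] using this
    rw [h0] at h
    have h1 := Nat.eq_of_mul_eq_mul_left hB (Nat.add_left_cancel h)
    intro n hn
    cases n with
    | zero => exact h0
    | succ n =>
      exact ih (fun n => a (n + 1)) (fun n => b (n + 1)) (fun n => ha _) (fun n => hb _) h1 n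
        (Nat.lt_of_succ_lt_succ hn)

/-- The multiplicities of a multiset with fewer than `B` elements are the digits in base `B` of the
sum of the powers `B ^ n`. -/
theorem Multiset.eq_of_sum_pow_eq {B : ℕ} {X Y : Multiset ℕ} (hX : X.card < B) (hY : Y.card < B)
    (h : (X.map fun n => B ^ n).sum = (Y.map fun n => B ^ n).sum) : X = Y := by
  classical
  obtain ⟨M, hM⟩ : ∃ M, ∀ n ∈ X + Y, n < M :=
    ⟨(X + Y).sum + 1, fun n hn => Nat.lt_succ_of_le (Multiset.le_sum_of_mem hn)⟩
  have expand : ∀ Z : Multiset ℕ, (∀ n ∈ Z, n < M) →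
      (Z.map fun n => B ^ n).sum = ∑ n ∈ Finset.range M, Z.count n * B ^ n := by
    intro Z hZ
    rw [Finset.sum_multiset_map_count]
    refine Finset.sum_subset (fun n hn => ?_) fun n _ hn => ?_
    · exact Finset.mem_range.2 (hZ n (Multiset.mem_toFinset.1 hn))
    · rw [Multiset.count_eq_zero_of_notMem (fun hm => hn (Multiset.mem_toFinset.2 hm)), zero_smul]
  have hXM : ∀ n ∈ X, n < M := fun n hn => hM n (Multiset.mem_add.2 (Or.inl hn))
  have hYM : ∀ n ∈ Y, n < M := fun n hn => hM n (Multiset.mem_add.2 (Or.inr hn))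
  rw [expand X hXM, expand Y hYM] at h
  have key := digits_eq_of_sum_eq M (fun n => X.count n) (fun n => Y.count n)
    (fun n => (Multiset.count_le_card n X).trans_lt hX)
    (fun n => (Multiset.count_le_card n Y).trans_lt hY) h
  ext n
  by_cases hn : n < M
  · exact key n hn
  · rw [Multiset.count_eq_zero_of_notMem fun h => hn (hXM n h),
      Multiset.count_eq_zero_of_notMem fun h => hn (hYM n h)]

theorem Multiset.eq_of_map_eq_of_injOn {α β : Type*} {f : α → β} {s : Set α} (hf : Set.InjOn f s)
    {X Y : Multiset α} (hX : ∀ z ∈ X, z ∈ s) (hY : ∀ z ∈ Y, z ∈ s) (h : X.map f = Y.map f) :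
    X = Y := by
  rcases X.empty_or_exists_mem with rfl | ⟨z, -⟩
  · exact (Multiset.map_eq_zero.1 h.symm).symm
  have : Nonempty α := ⟨z⟩
  have inv : ∀ Z : Multiset α, (∀ z ∈ Z, z ∈ s) → (Z.map f).map (Function.invFunOn f s) = Z := by
    intro Z hZ
    rw [Multiset.map_map]
    exact (Multiset.map_congr rfl fun z hz => hf.leftInvOn_invFunOn (hZ z hz)).trans
      (Multiset.map_id' Z)
  rw [← inv X hX, ← inv Y hY, h]

/-- The digit encoding of multisets over a set whose elements are numbered by `code`. -/
theorem Multiset.eq_of_sum_pow_code_eq {α : Type*} {code : α → ℕ} {s : Set α}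
    (hcode : Set.InjOn code s) {B : ℕ} {X Y : Multiset α} (hX : ∀ z ∈ X, z ∈ s)
    (hY : ∀ z ∈ Y, z ∈ s) (hXB : X.card < B) (hYB : Y.card < B)
    (h : (X.map fun z => (B : ℝ) ^ code z).sum = (Y.map fun z => (B : ℝ) ^ code z).sum) :
    X = Y := by
  refine Multiset.eq_of_map_eq_of_injOn hcode hX hY
    (Multiset.eq_of_sum_pow_eq (B := B) (by simpa using hXB) (by simpa using hYB) ?_)
  have cast : ∀ Z : Multiset α, (Z.map fun z => (B : ℝ) ^ code z).sum =
      ((((Z.map code).map fun n => B ^ n).sum : ℕ) : ℝ) := by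
    intro Z
    rw [Nat.cast_multiset_sum, Multiset.map_map, Multiset.map_map]
    simp [Function.comp_def]
  rw [cast, cast] at h
  exact_mod_cast h

/-- A multiset of at most `N` elements, to which one element is added `N + 1` times, remembers that
element: it is the only one of multiplicity greater than `N`. -/
theorem Multiset.eq_of_replicate_add_eq {α : Type*} {N : ℕ} {c c' : α} {X X' : Multiset α}
    (hX' : X'.card ≤ N)
    (h : Multiset.replicate (N + 1) c + X = Multiset.replicate (N + 1) c' + X') :
    c = c' ∧ X = X' := by
  classical
  have hc : c = c' := by
    by_contra hne
    have h1 := congrArg (Multiset.count c) h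
    rw [Multiset.count_add, Multiset.count_add, Multiset.count_replicate_self,
      Multiset.count_replicate, if_neg (Ne.symm hne)] at h1
    have := Multiset.count_le_card c X'
    omega
  subst hc
  exact ⟨rfl, add_left_cancel h⟩

end Digits

/-! ### Generic points and interpolation by ReLU networks -/

section Interpolation

variable {a b : ℕ}

theorem exists_forall_eval_ne_zero {ι : Type*} (s : Finset ι) (P : ι → Polynomial ℝ)
    (hP : ∀ i ∈ s, P i ≠ 0) : ∃ t : ℝ, ∀ i ∈ s, (P i).eval t ≠ 0 := by
  by_contra! H
  have hprod : ∏ i ∈ s, P i = 0 := Polynomial.funext fun t => by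
    obtain ⟨i, hi, h0⟩ := H t
    rw [Polynomial.eval_prod, Polynomial.eval_zero]
    exact Finset.prod_eq_zero hi h0
  obtain ⟨i, hi, h0⟩ := Finset.prod_eq_zero_iff.1 hprod
  exact hP i hi h0

/-- The direction can be taken on the moment curve `(1, t, t², …)`, scaled afterwards. -/
theorem exists_separating_direction (S : Finset (Vec a)) :
    ∃ w : Vec a, ∀ s ∈ S, ∀ s' ∈ S, s ≠ s' → 1 ≤ |w ⬝ᵥ s - w ⬝ᵥ s'| := by
  classical
  let P : Vec a × Vec a → Polynomial ℝ := fun q =>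
    ∑ i : Fin a, Polynomial.monomial (i : ℕ) (q.1 i - q.2 i)
  obtain ⟨t, ht⟩ := exists_forall_eval_ne_zero ((S ×ˢ S).filter fun q => q.1 ≠ q.2) P (by
    intro q hq h0
    refine (Finset.mem_filter.1 hq).2 (funext fun i => sub_eq_zero.1 ?_)
    have := congrArg (fun A => Polynomial.coeff A (i : ℕ)) h0
    simpa [P, Polynomial.finsetSum_coeff, Polynomial.coeff_monomial, Fin.val_inj] using this)
  let w₀ : Vec a := fun i => t ^ (i : ℕ)
  have hw : ∀ s ∈ S, ∀ s' ∈ S, s ≠ s' → 0 < |w₀ ⬝ᵥ s - w₀ ⬝ᵥ s'| := by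
    intro s hs s' hs' hne
    have := ht (s, s') (Finset.mem_filter.2 ⟨Finset.mk_mem_product hs hs', hne⟩)
    rw [abs_pos, ← dotProduct_sub]
    convert this using 1
    simp only [P, w₀, dotProduct, Polynomial.eval_finsetSum, Polynomial.eval_monomial, mul_comm,
      Pi.sub_apply]
  obtain ⟨M, hM⟩ := Finset.exists_le ((S ×ˢ S).image fun q => |w₀ ⬝ᵥ q.1 - w₀ ⬝ᵥ q.2|⁻¹)
  refine ⟨max M 0 • w₀, fun s hs s' hs' hne => ?_⟩
  have h1 : |w₀ ⬝ᵥ s - w₀ ⬝ᵥ s'|⁻¹ ≤ max M 0 :=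
    (hM _ (Finset.mem_image_of_mem (fun q : Vec a × Vec a => |w₀ ⬝ᵥ q.1 - w₀ ⬝ᵥ q.2|⁻¹)
      (Finset.mk_mem_product hs hs'))).trans (le_max_left _ _)
  rw [smul_dotProduct, smul_dotProduct, smul_eq_mul, smul_eq_mul, ← mul_sub, abs_mul,
    abs_of_nonneg (le_max_right M 0)]
  have h2 := hw s hs s' hs' hne
  calc (1 : ℝ) = |w₀ ⬝ᵥ s - w₀ ⬝ᵥ s'|⁻¹ * |w₀ ⬝ᵥ s - w₀ ⬝ᵥ s'| := (inv_mul_cancel₀ h2.ne').symm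
    _ ≤ _ := mul_le_mul_of_nonneg_right h1 h2.le

/-- Two-layer networks may have their hidden units indexed by any finite type. -/
theorem FFN.exists_of_fintype {ι : Type*} [Fintype ι] (W : ι → Vec a) (β : ι → ℝ) (c : ι → Vec b) :
    ∃ F : FFN a b, ∀ x, F.eval x = ∑ i, max (W i ⬝ᵥ x + β i) 0 • c i := by
  let e := Fintype.equivFin ι
  refine ⟨⟨Fintype.card ι, Matrix.of fun i => W (e.symm i), fun i => β (e.symm i),
    Matrix.of fun j i => c (e.symm i) j, 0⟩, fun x => ?_⟩
  funext j
  rw [← e.symm.sum_comp]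
  simp [FFN.eval, Matrix.mulVec, dotProduct, relu, Finset.sum_apply, mul_comm]

/-- Hat functions of width one along a direction that separates `S` by steps of at least one form a
dual basis of the points of `S`. -/
theorem FFN.exists_interpolation (S : Finset (Vec a)) (f : Vec a → Vec b) :
    ∃ F : FFN a b, ∀ s ∈ S, F.eval s = f s := by
  classical
  obtain ⟨w, hw⟩ := exists_separating_direction S
  obtain ⟨F, hF⟩ := FFN.exists_of_fintype (ι := S × Fin 3) (fun _ => w)
    (fun i => ![1, 0, -1] i.2 - w ⬝ᵥ (i.1 : Vec a))
    (fun i => (![1, -2, 1] i.2 : ℝ) • f i.1)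
  refine ⟨F, fun s hs => ?_⟩
  rw [hF, Fintype.sum_prod_type, Fintype.sum_eq_single (⟨s, hs⟩ : S)]
  · simp [Fin.sum_univ_three]
  · rintro ⟨s', hs'⟩ hne
    have hgap := hw s hs s' hs' fun h => hne (Subtype.ext h.symm)
    have hhat : max (w ⬝ᵥ s + (1 - w ⬝ᵥ s')) 0 - 2 * max (w ⬝ᵥ s + (0 - w ⬝ᵥ s')) 0 +
        max (w ⬝ᵥ s + (-1 - w ⬝ᵥ s')) 0 = 0 := by
      rcases le_abs.1 hgap with h | h
      · rw [max_eq_left (by linarith), max_eq_left (by linarith), max_eq_left (by linarith)]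
        ring
      · rw [max_eq_right (by linarith), max_eq_right (by linarith), max_eq_right (by linarith)]
        ring
    simp only [Fin.sum_univ_three, Matrix.cons_val_zero, Matrix.cons_val_one, Matrix.cons_val,
      smul_smul, ← add_smul]
    rw [show ∀ A B C : ℝ, A * 1 + B * -2 + C * 1 = A - 2 * B + C by intros; ring, hhat, zero_smul]

/-- `y = max y 0 - max (-y) 0` in each coordinate. -/
theorem FFN.exists_eval_eq_id (n : ℕ) : ∃ F : FFN n n, F.eval = id := by
  obtain ⟨F, hF⟩ := FFN.exists_of_fintype (ι := Fin n × Bool) (a := n) (b := n)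
    (fun i => (if i.2 then 1 else -1 : ℝ) • Pi.single i.1 1) (fun _ => 0)
    (fun i => (if i.2 then 1 else -1 : ℝ) • Pi.single i.1 1)
  refine ⟨F, funext fun y => funext fun j => ?_⟩
  rw [hF, Fintype.sum_prod_type, Finset.sum_apply, Fintype.sum_eq_single j]
  · rcases le_total (y j) 0 with h | h <;> simp [h]
  · intro i hi
    simp [Pi.single_eq_of_ne hi.symm]

/-- The second hidden layer is the identity, which ReLU does not change on nonnegative vectors. -/
theorem MLP.exists_eval_eq_ffn (F : FFN a b) : ∃ M : MLP a b, M.eval = F.eval := by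
  refine ⟨⟨F.width, F.width, F.W₁, F.b₁, 1, 0, F.W₂, F.b₂⟩, funext fun x => ?_⟩
  have : ∀ y : Vec F.width, relu (relu y) = relu y := fun y =>
    funext fun i => max_eq_left (le_max_right _ _)
  simp only [MLP.eval, FFN.eval, Matrix.one_mulVec, add_zero, this]

/-- Interpolation of a function of the pairs of entities that factors through a vector-valued
one. -/
theorem FFN.exists_factor {V : Type*} [Finite V] {y : V → V → Vec a} {o : V → V → Vec b}
    (H : Refines y o) : ∃ F : FFN a b, ∀ h u, F.eval (y h u) = o h u := by
  obtain ⟨φ, hφ⟩ := H.exists_factor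
  obtain ⟨F, hF⟩ := FFN.exists_interpolation (Set.finite_range (Function.uncurry y)).toFinset φ
  exact ⟨F, fun h u => by
    rw [hφ]
    exact hF _ ((Set.Finite.mem_toFinset _).2 ⟨(h, u), rfl⟩)⟩

theorem MLP.exists_factor {V : Type*} [Finite V] {y : V → V → Vec a} {o : V → V → Vec b}
    (H : Refines y o) : ∃ M : MLP a b, ∀ h u, M.eval (y h u) = o h u := by
  obtain ⟨F, hF⟩ := FFN.exists_factor H
  obtain ⟨M, hM⟩ := MLP.exists_eval_eq_ffn F
  exact ⟨M, by rwa [hM]⟩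

end Interpolation

/-! ### Value networks that compute the test -/

section Expressiveness

variable {V R D : Type*} [Fintype V] [Fintype R]

/-- What one round of the test records at a pair, as one multiset: the color of the pair, without a
relation, together with the colors and relations of the incoming facts. -/
noncomputable def tagged {α : Type*} (G : KnowledgeGraph V R) (c : V → V → α) (h u : V) :
    Multiset (α × Option R) :=
  (c h u, none) ::ₘ (G.incoming u).val.map fun e => (c h e.1, some e.2)

theorem rawl_succ_eq_of_tagged_eq (G : KnowledgeGraph V R) (η : V → V → D) (t : ℕ) {h u h' u' : V}
    (e : tagged G (rawl G η t) h u = tagged G (rawl G η t) h' u') :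
    rawl G η (t + 1) h u = rawl G η (t + 1) h' u' := by
  have hc : rawl G η t h u = rawl G η t h' u' := by
    have hm : (rawl G η t h u, none) ∈ tagged G (rawl G η t) h' u' :=
      e ▸ Multiset.mem_cons_self _ _
    rcases Multiset.mem_cons.1 hm with h1 | h1
    · exact congrArg Prod.fst h1
    · obtain ⟨q, -, hq⟩ := Multiset.mem_map.1 h1
      exact absurd (congrArg Prod.snd hq) (Option.some_ne_none _)
  have hX : (G.incoming u).val.map (fun q => (rawl G η t h q.1, q.2)) =
      (G.incoming u').val.map (fun q => (rawl G η t h' q.1, q.2)) := by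
    rw [tagged, tagged, hc, Multiset.cons_inj_right] at e
    refine Multiset.map_injective (f := fun q : RAColor D R t × R => (q.1, some q.2)) ?_ ?_
    · rintro ⟨a, r⟩ ⟨a', r'⟩ hq
      simpa using hq
    · simpa only [Multiset.map_map, Function.comp_def] using e
  exact Prod.ext hc hX

theorem mem_range_of_mem_tagged {α : Type*} {G : KnowledgeGraph V R} {c : V → V → α} {h u : V}
    {q : α × Option R} (hq : q ∈ tagged G c h u) : q.1 ∈ Set.range (Function.uncurry c) := by
  rcases Multiset.mem_cons.1 hq with rfl | h1
  · exact ⟨(h, u), rfl⟩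
  · obtain ⟨e, -, rfl⟩ := Multiset.mem_map.1 h1
    exact ⟨(h, e.1), rfl⟩

theorem card_tagged_lt {α : Type*} (G : KnowledgeGraph V R) (c : V → V → α) (h u : V) :
    (tagged G c h u).card < Fintype.card (V × R) + 2 := by
  rw [tagged, Multiset.card_cons, Multiset.card_map]
  have : (G.incoming u).val.card ≤ Fintype.card (V × R) := Finset.card_le_univ _
  omega

/-- One layer embeds the colors of the initialization; each further layer performs one round. Colors
are carried as single powers `B ^ (code c * K)` of a large base, and the relation vectors shift the
exponent by the number of the relation, so that the sum formed by the next layer has the recorded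
multiset as its digits; the update network then reads off any function of it. -/
theorem StructNet.exists_run_eq {p a : ℕ} (G : KnowledgeGraph V R) (rq : Vec p)
    {I : V → V → Vec a} {η : V → V → D} (hI : Refines I η) (T : ℕ) :
    ∀ {b : ℕ} (out : RAColor D R T → Vec b), ∃ S : StructNet R p a b, S.depth = T + 1 ∧
      ∀ h u, S.run G rq (I h) u = out (rawl G η T h u) := by
  induction T with
  | zero =>
    intro b out
    obtain ⟨M, hM⟩ := MLP.exists_factor (y := I) (o := fun h u => out (rawl G η 0 h u))
      fun h u h' u' e => congrArg (fun c => out (ULift.up c)) (hI h u h' u' e)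
    refine ⟨.snoc (.nil a) ⟨1, 0, 0, M⟩, by simp only [StructNet.depth], fun h u => ?_⟩
    rw [← hM h u]
    simp [StructNet.run, StructLayer.apply, StructLayer.relVec]
  | succ T ih =>
    intro b out
    obtain ⟨code, hcode⟩ := exists_code (rawl G η T)
    let K := Fintype.card (Option R)
    let ι : Option R → Fin K := Fintype.equivFin (Option R)
    let B := Fintype.card (V × R) + 2
    let code' : RAColor D R T × Option R → ℕ := fun q => code q.1 * K + ι q.2
    have hcode' : Set.InjOn code' {q | q.1 ∈ Set.range (Function.uncurry (rawl G η T))} := by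
      rintro ⟨c, r⟩ hc ⟨c', r'⟩ hc' e
      have hK : 0 < K := Fintype.card_pos
      have e1 := congrArg (· / K) e
      have e2 := congrArg (· % K) e
      simp only [code', Nat.mul_comm _ K, Nat.mul_add_div hK, Nat.div_eq_of_lt (ι _).2,
        add_zero] at e1
      simp only [code', Nat.mul_comm _ K, Nat.mul_add_mod, Nat.mod_eq_of_lt (ι _).2] at e2
      exact Prod.ext (hcode hc hc' e1) ((Fintype.equivFin (Option R)).injective (Fin.ext e2))
    obtain ⟨S, hS, hrun⟩ := ih fun c => (fun _ => (B : ℝ) ^ (code c * K) : Vec 1)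
    let pre : V → V → Vec 1 := fun h u _ =>
      ((tagged G (rawl G η T) h u).map fun q => (B : ℝ) ^ code' q).sum
    obtain ⟨M, hM⟩ := MLP.exists_factor (y := pre) (o := fun h u => out (rawl G η (T + 1) h u))
      fun h u h' u' e => congrArg out (rawl_succ_eq_of_tagged_eq G η T
        (Multiset.eq_of_sum_pow_code_eq hcode' (fun _ => mem_range_of_mem_tagged)
          (fun _ => mem_range_of_mem_tagged) (card_tagged_lt G _ h u) (card_tagged_lt G _ h' u')
          (congrFun e 0)))
    refine ⟨.snoc S ⟨fun _ => (B : ℝ) ^ (ι none : ℕ), 0, fun r _ => (B : ℝ) ^ (ι (some r) : ℕ), M⟩,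
      by simp only [StructNet.depth, hS], fun h u => ?_⟩
    rw [← hM h u]
    simp only [StructNet.run, StructLayer.apply]
    congr 1
    funext i
    simp only [Pi.add_apply, Pi.mul_apply, Finset.sum_apply, hrun, StructLayer.relVec,
      Pi.zero_apply, Matrix.zero_mulVec, zero_add, pre, tagged, code', Multiset.map_cons,
      Multiset.sum_cons, Multiset.map_map, Function.comp_def, pow_add]
    rw [mul_comm]
    rfl

/-- Given an output coordinate, the colors can be numbered there. -/
theorem StructNet.exists_samePartition {p a : ℕ} (G : KnowledgeGraph V R) (rq : Vec p)
    {I : V → V → Vec a} {η : V → V → D} (hI : Refines I η) (T b : ℕ) (hb : 0 < b) :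
    ∃ S : StructNet R p a b, S.depth = T + 1 ∧
      SamePartition (fun h => S.run G rq (I h)) (rawl G η T) := by
  obtain ⟨code, hcode⟩ := exists_code (rawl G η T)
  obtain ⟨S, hS, hrun⟩ := StructNet.exists_run_eq G rq hI T (b := b) fun c _ => (code c : ℝ)
  refine ⟨S, hS, fun h u h' u' => ?_⟩
  simp only [hrun]
  refine ⟨fun e => hcode ⟨(h, u), rfl⟩ ⟨(h', u'), rfl⟩ ?_, fun e => by rw [e]⟩
  exact_mod_cast congrFun e ⟨0, hb⟩

end Expressiveness

/-! ### Injective updates of a vector and a multiset -/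

section Updates

theorem injectiveUpdateOn_multisetUpdate {m p n N : ℕ} (hp : 0 < p) {Z : Set (Vec m)}
    {code : Vec m → ℕ} (hcode : Set.InjOn code Z) {f : Vec m → Vec p}
    (hf : ∀ z ∈ Z, f z = fun _ => ((2 * N + 2 : ℕ) : ℝ) ^ code z) {g : Vec p → Vec n}
    (hg : Function.Injective g) : InjectiveUpdateOn (multisetUpdate g f N) Z N := by
  intro c hc c' hc' X X' hX hX' hN hN' e
  have e0 := hg e
  have sum_eq : ∀ c ∈ Z, ∀ X : Multiset (Vec m), (∀ z ∈ X, z ∈ Z) →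
      ((1 + (N : ℝ)) • f c + (X.map f).sum) ⟨0, hp⟩ =
        ((Multiset.replicate (N + 1) c + X).map fun z => ((2 * N + 2 : ℕ) : ℝ) ^ code z).sum := by
    intro c hc X hX
    rw [Multiset.map_congr rfl fun z hz => hf z (hX z hz), hf c hc, Multiset.map_add,
      Multiset.sum_add, Multiset.map_replicate, Multiset.sum_replicate, Pi.add_apply]
    congr 1
    · simp [add_comm]
    · exact (map_multiset_sum (Pi.evalAddMonoidHom (fun _ : Fin p => ℝ) ⟨0, hp⟩) _).trans
        (congrArg Multiset.sum (Multiset.map_map _ _ _))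
  have mem : ∀ c ∈ Z, ∀ X : Multiset (Vec m), (∀ z ∈ X, z ∈ Z) →
      ∀ z ∈ Multiset.replicate (N + 1) c + X, z ∈ Z := by
    intro c hc X hX z hz
    rcases Multiset.mem_add.1 hz with h | h
    · exact Multiset.eq_of_mem_replicate h ▸ hc
    · exact hX z h
  refine Multiset.eq_of_replicate_add_eq hN' (Multiset.eq_of_sum_pow_code_eq
    (B := 2 * N + 2) hcode (mem c hc X hX) (mem c' hc' X' hX') ?_ ?_ ?_)
  · simp only [Multiset.card_add, Multiset.card_replicate]; omega
  · simp only [Multiset.card_add, Multiset.card_replicate]; omega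
  · rw [← sum_eq c hc X hX, ← sum_eq c' hc' X' hX', e0]

/-- The summands `B ^ code z` with `B = 2 N + 2` and the factor `1 + ζ = N + 1`: a digit exceeds
`N` exactly at the distinguished element. -/
theorem exists_injectiveUpdateOn {m p N : ℕ} {Z : Set (Vec m)} (hp : 0 < p) (hZ : Z.Countable) :
    ∃ (f : Vec m → Vec p) (ζ : ℝ), InjectiveUpdateOn (multisetUpdate id f ζ) Z N ∧
      ∀ S : Finset (Vec m), (S : Set (Vec m)) ⊆ Z → ∃ (F : FFN m p) (g : FFN p p),
        (∀ z ∈ S, F.eval z = f z) ∧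
        InjectiveUpdateOn (multisetUpdate g.eval F.eval ζ) (S : Set (Vec m)) N := by
  obtain ⟨code, hcode⟩ := Set.countable_iff_exists_injOn.1 hZ
  refine ⟨fun z _ => ((2 * N + 2 : ℕ) : ℝ) ^ code z, N,
    injectiveUpdateOn_multisetUpdate hp hcode (fun _ _ => rfl) Function.injective_id,
    fun S hS => ?_⟩
  obtain ⟨F, hF⟩ := FFN.exists_interpolation S
    (fun z => (fun _ => ((2 * N + 2 : ℕ) : ℝ) ^ code z : Vec p))
  obtain ⟨g, hg⟩ := FFN.exists_eval_eq_id p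
  exact ⟨F, g, hF, injectiveUpdateOn_multisetUpdate hp (hcode.mono hS) hF
    (hg ▸ Function.injective_id)⟩

theorem exists_ffn_update_samePartition {V : Type*} [Finite V] {m : ℕ} (c : V → V → Vec m)
    (X : V → V → Multiset (Vec m)) (N : ℕ) (hX : ∀ h u, (X h u).card = N) :
    ∃ (F g : FFN m m) (ζ : ℝ),
      SamePartition (fun h u => multisetUpdate g.eval F.eval ζ (c h u) (X h u))
        (fun h u => (c h u, X h u)) := by
  classical
  obtain ⟨g₀, -⟩ := FFN.exists_eval_eq_id m
  rcases Nat.eq_zero_or_pos m with rfl | hm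
  · -- all vectors of dimension zero agree, and the multisets have equal size
    refine ⟨g₀, g₀, 0, fun h u h' u' => ⟨fun _ => Prod.ext (Subsingleton.elim _ _) ?_,
      fun _ => Subsingleton.elim _ _⟩⟩
    change X h u = X h' u'
    rw [Multiset.eq_replicate.2 ⟨hX h u, fun z _ => Subsingleton.elim z 0⟩,
      Multiset.eq_replicate.2 ⟨hX h' u', fun z _ => Subsingleton.elim z 0⟩]
  cases nonempty_fintype V
  let S : Finset (Vec m) := Finset.univ.biUnion fun q : V × V =>
    insert (c q.1 q.2) (X q.1 q.2).toFinset
  have hcS : ∀ h u, c h u ∈ (S : Set (Vec m)) := fun h u =>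
    Finset.mem_biUnion.2 ⟨(h, u), Finset.mem_univ _, Finset.mem_insert_self _ _⟩
  have hXS : ∀ h u, ∀ z ∈ X h u, z ∈ (S : Set (Vec m)) := fun h u z hz =>
    Finset.mem_biUnion.2 ⟨(h, u), Finset.mem_univ _,
      Finset.mem_insert_of_mem (Multiset.mem_toFinset.2 hz)⟩
  clear_value S
  obtain ⟨f, ζ, -, H⟩ := exists_injectiveUpdateOn (N := N) hm S.countable_toSet
  obtain ⟨F, g, -, hinj⟩ := H S subset_rfl
  refine ⟨F, g, ζ, fun h u h' u' => ⟨fun e => ?_, fun e => ?_⟩⟩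
  · obtain ⟨h1, h2⟩ := hinj (c h u) (hcS h u) (c h' u') (hcS h' u') (X h u) (X h' u') (hXS h u)
      (hXS h' u') (hX h u).le (hX h' u').le e
    exact Prod.ext h1 h2
  · obtain ⟨h1, h2⟩ := Prod.mk.inj e
    simp only [h1, h2]

end Updates

/-! ### Layer normalization -/

section Normalization

variable {d : ℕ}

/-- The trivial scale and shift. -/
def LayerNorm.standard (d : ℕ) : LayerNorm d := ⟨1, 0⟩

/-- A positive stabilizing constant makes layer normalization forget only the mean: the normalized
vector has squared length `d * v / (v + δ)` for the variance `v`, and this determines `v`. -/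
theorem LayerNorm.sub_eq_sub_of_eval_eq {δ : ℝ} (hδ : 0 < δ) {y y' : Vec d}
    (e : (LayerNorm.standard d).eval δ y = (LayerNorm.standard d).eval δ y') (i j : Fin d) :
    y i - y j = y' i - y' j := by
  have hd : (0 : ℝ) < d := Nat.cast_pos.2 (i.pos)
  let μ : Vec d → ℝ := fun y => (∑ i, y i) / d
  let var : Vec d → ℝ := fun y => (∑ i, (y i - μ y) ^ 2) / d
  have hvar : ∀ y, 0 ≤ var y := fun y =>
    div_nonneg (Finset.sum_nonneg fun _ _ => sq_nonneg _) hd.le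
  have heval : ∀ y i, (LayerNorm.standard d).eval δ y i = (y i - μ y) / √(var y + δ) := by
    intro y i
    simp [LayerNorm.eval, LayerNorm.standard, μ, var]
  have hsq : ∀ y, (∑ i, ((LayerNorm.standard d).eval δ y i) ^ 2) / d = 1 - δ / (var y + δ) := by
    intro y
    have hpos : 0 < var y + δ := add_pos_of_nonneg_of_pos (hvar y) hδ
    simp only [heval, div_pow, Real.sq_sqrt hpos.le, ← Finset.sum_div]
    rw [div_right_comm]
    change var y / (var y + δ) = _
    field_simp
    ring
  have hv : var y = var y' := by
    have h1 : δ / (var y + δ) = δ / (var y' + δ) := by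
      have := hsq y
      rw [e, hsq y'] at this
      linarith
    have hpos : 0 < var y + δ := add_pos_of_nonneg_of_pos (hvar y) hδ
    have hpos' : 0 < var y' + δ := add_pos_of_nonneg_of_pos (hvar y') hδ
    rw [div_eq_div_iff hpos.ne' hpos'.ne'] at h1
    linarith [mul_left_cancel₀ hδ.ne' h1]
  have hs : √(var y' + δ) ≠ 0 :=
    (Real.sqrt_pos.2 (add_pos_of_nonneg_of_pos (hvar y') hδ)).ne'
  have center : ∀ i, y i - μ y = y' i - μ y' := by
    intro i
    have := congrFun e i
    rw [heval, heval, hv] at this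
    exact (div_left_inj' hs).1 this
  linarith [center i, center j]

end Normalization

/-! ### The attention layer -/

section AttentionLayer

variable {V R D : Type*}

theorem sum_sq_normalized_le_one {n : ℕ} (a : Vec n) : ∑ i, (((l2norm a)⁻¹ • a) i) ^ 2 ≤ 1 := by
  have h0 : 0 ≤ ∑ i, a i ^ 2 := Finset.sum_nonneg fun _ _ => sq_nonneg _
  simp only [Pi.smul_apply, smul_eq_mul, mul_pow, ← Finset.mul_sum, inv_pow]
  rw [l2norm, Real.sq_sqrt h0]
  exact inv_mul_le_one

theorem ScoreParams.kernel_nonneg {d k : ℕ} (Q : ScoreParams R d k) (z z' : Vec Q.qdim) :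
    0 ≤ Q.kernel z z' := by
  have key : ∀ a b : Vec Q.kdim, ∑ i, a i ^ 2 ≤ 1 → ∑ i, b i ^ 2 ≤ 1 → 0 ≤ 1 + a ⬝ᵥ b := by
    intro a b ha hb
    have h : 0 ≤ ∑ i, (a i + b i) ^ 2 := Finset.sum_nonneg fun _ _ => sq_nonneg _
    have e : ∑ i, (a i + b i) ^ 2 = ∑ i, a i ^ 2 + ∑ i, b i ^ 2 + 2 * (a ⬝ᵥ b) := by
      rw [dotProduct, Finset.mul_sum, ← Finset.sum_add_distrib, ← Finset.sum_add_distrib]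
      exact Finset.sum_congr rfl fun i _ => by ring
    linarith
  exact key _ _ (sum_sq_normalized_le_one _) (sum_sq_normalized_le_one _)

variable [Fintype V] [Fintype R]

theorem ScoreParams.score_nonneg {d k : ℕ} (Q : ScoreParams R d k) (G : KnowledgeGraph V R)
    (rq : Vec d) (x : V → Vec d) (ε : V → Vec k) (u v : V) : 0 ≤ Q.score G rq x ε u v :=
  div_nonneg (Q.kernel_nonneg _ _) (Finset.sum_nonneg fun _ _ => Q.kernel_nonneg _ _)

theorem ScoreParams.sum_score_le_one {d k : ℕ} (Q : ScoreParams R d k) (G : KnowledgeGraph V R)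
    (rq : Vec d) (x : V → Vec d) (ε : V → Vec k) (u : V) : ∑ v, Q.score G rq x ε u v ≤ 1 := by
  simp only [ScoreParams.score, ← Finset.sum_div]
  exact div_self_le_one _

/-- With the values `t ^ (m h u)` along one coordinate, the input of the first normalization is a
polynomial in `t` whose coefficient at `m h u` is at least the number of entities, while the scores
contribute at most one to any coefficient. So pairs with different `m` have different polynomials,
and they are still separated at a generic `t`. -/
theorem exists_separating_parameter (m : V → V → ℕ) (hm : ∀ h u, m h u ≠ 0)
    (s : V → V → V → ℝ) (hs : ∀ h u v, 0 ≤ s h u v) (hs1 : ∀ h u, ∑ v, s h u v ≤ 1)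
    (κ : V → V → ℝ) :
    ∃ t : ℝ, Refines
      (fun h u => (Fintype.card V : ℝ) * t ^ m h u + ∑ v, s h u v * t ^ m h v + κ h u) m := by
  classical
  let A : V → V → Polynomial ℝ := fun h u =>
    Polynomial.monomial (m h u) (Fintype.card V : ℝ) +
      ∑ v, Polynomial.monomial (m h v) (s h u v) + Polynomial.C (κ h u)
  have hcoeff : ∀ h u n, n ≠ 0 → (A h u).coeff n =
      (if m h u = n then (Fintype.card V : ℝ) else 0) +
        ∑ v, if m h v = n then s h u v else 0 := by
    intro h u n hn
    simp [A, Polynomial.coeff_monomial, Polynomial.finsetSum_coeff, Polynomial.coeff_C, hn]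
  obtain ⟨t, ht⟩ := exists_forall_eval_ne_zero
    (Finset.univ.filter fun q : (V × V) × (V × V) => m q.1.1 q.1.2 ≠ m q.2.1 q.2.2)
    (fun q => A q.1.1 q.1.2 - A q.2.1 q.2.2) (by
      rintro ⟨⟨h, u⟩, ⟨h', u'⟩⟩ hq h0
      have hne : m h u ≠ m h' u' := (Finset.mem_filter.1 hq).2
      have hcard : (2 : ℝ) ≤ Fintype.card V := by
        have : Nontrivial V := by
          by_contra hV
          have := not_nontrivial_iff_subsingleton.1 hV
          exact hne (by rw [Subsingleton.elim h h', Subsingleton.elim u u'])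
        exact_mod_cast Fintype.one_lt_card (α := V)
      have e := congrArg (fun P => Polynomial.coeff P (m h u)) h0
      simp only [Polynomial.coeff_sub, Polynomial.coeff_zero, hcoeff _ _ _ (hm h u), if_true,
        if_neg hne.symm] at e
      have lower : 0 ≤ ∑ v, if m h v = m h u then s h u v else 0 :=
        Finset.sum_nonneg fun v _ => by split_ifs <;> simp [hs]
      have upper : (∑ v, if m h' v = m h u then s h' u' v else 0) ≤ 1 :=
        (Finset.sum_le_sum fun v _ => by split_ifs <;> simp [hs]).trans (hs1 h' u')
      linarith)
  have heval : ∀ h u, (A h u).eval t =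
      (Fintype.card V : ℝ) * t ^ m h u + ∑ v, s h u v * t ^ m h v + κ h u := by
    intro h u
    simp [A, Polynomial.eval_finsetSum]
  refine ⟨t, fun h u h' u' e => ?_⟩
  by_contra hne
  refine ht ((h, u), (h', u')) (Finset.mem_filter.2 ⟨Finset.mem_univ _, hne⟩) ?_
  rw [Polynomial.eval_sub, heval, heval, sub_eq_zero]
  exact e

/-- The values lie on the first coordinate axis at a generic scale, so that the first normalization,
which preserves the difference of two coordinates, separates pairs of different colors. The
feed-forward network then merges everything else, in particular what the scores reveal beyond the
test. -/
theorem exists_outParams_samePartition [DecidableEq V] {d : ℕ} (hd : 2 ≤ d) {δ : ℝ} (hδ : 0 < δ)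
    (G : KnowledgeGraph V R) (rq : Vec d) (x : V → V → Vec d) (η : V → V → D)
    (hη : Refines (fun h u => valueInit rq h (x h) u) η) (T : ℕ)
    (s : V → V → V → ℝ) (hs : ∀ h u v, 0 ≤ s h u v) (hs1 : ∀ h u, ∑ v, s h u v ≤ 1) :
    ∃ P : OutParams R d, P.value.depth = T + 1 ∧
      SamePartition (fun h u => P.norm₂.eval δ (P.ffn.eval (P.norm₁.eval δ
        ((Fintype.card V : ℝ) • P.value.run G rq (valueInit rq h (x h)) u +
          ∑ v, s h u v • P.value.run G rq (valueInit rq h (x h)) v + x h u))))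
        (rawl G η T) := by
  let i₀ : Fin d := ⟨0, by omega⟩
  let i₁ : Fin d := ⟨1, by omega⟩
  have h10 : i₁ ≠ i₀ := fun h => absurd (congrArg Fin.val h) one_ne_zero
  obtain ⟨code, hcode⟩ := exists_code (rawl G η T)
  obtain ⟨t, ht⟩ := exists_separating_parameter (fun h u => code (rawl G η T h u) + 1)
    (fun _ _ => Nat.succ_ne_zero _) s hs hs1 (fun h u => x h u i₀ - x h u i₁)
  obtain ⟨S, hS, hrun⟩ := StructNet.exists_run_eq G rq hη T (b := d)
    fun c => Pi.single i₀ (t ^ (code c + 1))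
  let y : V → V → Vec d := fun h u => (LayerNorm.standard d).eval δ
    ((Fintype.card V : ℝ) • S.run G rq (valueInit rq h (x h)) u +
      ∑ v, s h u v • S.run G rq (valueInit rq h (x h)) v + x h u)
  have hy : Refines y (fun h u => code (rawl G η T h u)) := by
    intro h u h' u' e
    have e1 := LayerNorm.sub_eq_sub_of_eval_eq hδ e i₀ i₁
    simp only [hrun, Pi.add_apply, Pi.smul_apply, Finset.sum_apply, Pi.single_eq_same,
      Pi.single_eq_of_ne h10, smul_eq_mul, mul_zero, Finset.sum_const_zero, zero_add,
      add_sub_assoc] at e1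
    exact Nat.succ_injective (ht h u h' u' e1)
  obtain ⟨F, hF⟩ := FFN.exists_factor (y := y)
    (o := fun h u => (Pi.single i₀ (code (rawl G η T h u) : ℝ) : Vec d))
    fun h u h' u' e => by simp only [hy h u h' u' e]
  refine ⟨⟨S, LayerNorm.standard d, F, LayerNorm.standard d⟩, hS, fun h u h' u' => ?_⟩
  change (LayerNorm.standard d).eval δ (F.eval (y h u)) =
    (LayerNorm.standard d).eval δ (F.eval (y h' u')) ↔ _
  rw [hF, hF]
  refine ⟨fun e => hcode ⟨(h, u), rfl⟩ ⟨(h', u'), rfl⟩ ?_, fun e => by rw [e]⟩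
  have e1 := LayerNorm.sub_eq_sub_of_eval_eq hδ e i₀ i₁
  simp only [Pi.single_eq_same, Pi.single_eq_of_ne h10, sub_zero] at e1
  exact_mod_cast e1

theorem exists_attentionLayer_samePartition [DecidableEq V] {d k : ℕ} (hd : 2 ≤ d) {δ : ℝ}
    (hδ : 0 < δ) (G : KnowledgeGraph V R) (rq : Vec d) (x : V → V → Vec d) (η : V → V → D)
    (hη : Refines (fun h u => valueInit rq h (x h) u) η) (T : ℕ) (Q : ScoreParams R d k)
    (ε : V → V → Vec k) :
    ∃ P : OutParams R d, P.value.depth = T + 1 ∧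
      SamePartition (fun h => attentionLayer Q P G δ rq h (x h) (ε h)) (rawl G η T) :=
  exists_outParams_samePartition hd hδ G rq x η hη T (fun h => Q.score G rq (x h) (ε h))
    (fun h => Q.score_nonneg G rq (x h) (ε h)) (fun h => Q.sum_score_le_one G rq (x h) (ε h))

/-- Query parameters with vanishing projections, for which all scores are equal. -/
def ScoreParams.uniform (R : Type*) (d k : ℕ) : ScoreParams R d k := ⟨_, .nil _, 0, 0, 0, 0, 0⟩

theorem ScoreParams.score_uniform {d k : ℕ} (G : KnowledgeGraph V R) (rq : Vec d)
    (x : V → Vec d) (ε ε' : V → Vec k) :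
    (ScoreParams.uniform R d k).score G rq x ε = (ScoreParams.uniform R d k).score G rq x ε' := by
  have h : ∀ z z', (ScoreParams.uniform R d k).kernel z z' = 1 := fun z z' =>
    add_eq_left.2 (Finset.sum_empty)
  funext u v
  simp only [ScoreParams.score, h]

theorem attentionLayer_uniform [DecidableEq V] {d k : ℕ} (P : OutParams R d)
    (G : KnowledgeGraph V R) (δ : ℝ) (rq : Vec d) (h : V) (x : V → Vec d) (ε ε' : V → Vec k) :
    attentionLayer (ScoreParams.uniform R d k) P G δ rq h x ε =
      attentionLayer (ScoreParams.uniform R d k) P G δ rq h x ε' := by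
  funext u
  simp only [attentionLayer, ScoreParams.attention, ScoreParams.weighted,
    ScoreParams.score_uniform G rq x ε ε']

end AttentionLayer

/-! ### Target node distinguishability -/

section Distinguishability

variable {V D : Type*}

theorem targetNodeDistinguishable_valueInit [DecidableEq V] {d : ℕ} {rq : Vec d} (hrq : rq ≠ 0)
    (x : V → V → Vec d) : TargetNodeDistinguishable (fun h u => valueInit rq h (x h) u) := by
  intro u v huv e
  refine hrq (funext fun i => ?_)
  have := congrFun e (Fin.natAdd d i)
  simpa only [valueInit, Fin.append_right, if_true, if_neg huv.symm] using this

variable [Fintype V] {d k : ℕ}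

instance isProbabilityMeasure_gaussianFeatures :
    IsProbabilityMeasure (gaussianFeatures V k) := by
  unfold gaussianFeatures
  infer_instance

/-- The first features of two entities are independent and without atoms. -/
theorem gaussianFeatures_eq_null (hk : 0 < k) {u v : V} (huv : u ≠ v) :
    gaussianFeatures V k {ε | ε u = ε v} = 0 := by
  let ν : Measure (Vec k) := Measure.pi fun _ => gaussianReal 0 1
  let j : Fin k := ⟨0, hk⟩
  let E : Set (Vec k × Vec k) := {q | q.1 j = q.2 j}
  have hE : MeasurableSet E := measurableSet_eq_fun (by fun_prop) (by fun_prop)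
  have hind : IndepFun (fun ε : V → Vec k => ε u) (fun ε => ε v) (gaussianFeatures V k) :=
    (iIndepFun_pi (μ := fun _ : V => ν) (X := fun _ => id) fun _ => aemeasurable_id).indepFun huv
  have hmap := (indepFun_iff_map_prod_eq_prod_map_map (measurable_pi_apply u).aemeasurable
    (measurable_pi_apply v).aemeasurable).1 hind
  have hev : ∀ w, (gaussianFeatures V k).map (fun ε => ε w) = ν := fun w =>
    (measurePreserving_eval (fun _ : V => ν) w).map_eq
  rw [hev, hev] at hmap
  have hnull : ν.prod ν E = 0 := by
    refine (Measure.measure_prod_null hE).2 (ae_of_all _ fun y => ?_)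
    change ν ((fun y' : Vec k => y' j) ⁻¹' {r | y j = r}) = 0
    have hmp : MeasurePreserving (fun y' : Vec k => y' j) ν (gaussianReal 0 1) :=
      measurePreserving_eval (fun _ : Fin k => gaussianReal 0 1) j
    have := nullSingletonClass_gaussianReal (μ := 0) one_ne_zero
    rw [show {r | y j = r} = {y j} from Set.ext fun r => eq_comm,
      hmp.measure_preimage (measurableSet_singleton _).nullMeasurableSet]
    exact measure_singleton _
  rw [← hmap, Measure.map_apply (by fun_prop) hE] at hnull
  exact measure_mono_null (fun ε (hε : ε u = ε v) => congrFun hε j) hnull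

theorem queryInit_eq_null (x : V → Vec d) (hk : 0 < k) {u v : V} (huv : u ≠ v) :
    gaussianFeatures V k {ε | queryInit x ε u = queryInit x ε v} = 0 := by
  refine measure_mono_null (fun ε hε => funext fun i => ?_) (gaussianFeatures_eq_null hk huv)
  have := congrFun hε (Fin.natAdd d i)
  simpa only [queryInit, Fin.append_right] using this

theorem queryInit_ne_full (x : V → Vec d) (hk : 0 < k) (h : V) :
    gaussianFeatures V k {ε | ∀ v, h ≠ v → queryInit x ε h ≠ queryInit x ε v} = 1 := by
  have hae : ∀ᵐ ε ∂gaussianFeatures V k, ∀ v, h ≠ v → queryInit x ε h ≠ queryInit x ε v :=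
    ae_all_iff.2 fun v => by
      by_cases hv : h = v
      · exact ae_of_all _ fun ε hne => absurd hv hne
      · refine measure_mono_null (fun ε hε => ?_) (queryInit_eq_null x hk hv)
        simpa [hv] using hε
  exact (measure_congr (eventuallyEq_univ.2 hae)).trans measure_univ

end Distinguishability

/-! ### Expressiveness of the attention layer and its components -/

theorem theorem2 {V R D : Type*} [Fintype V] [DecidableEq V] [Fintype R]
    (d : ℕ) (hd : 2 ≤ d) (δ : ℝ) (hδ : 0 < δ)
    (G : KnowledgeGraph V R) (rq : Vec d) (hrq : rq ≠ 0)
    (x : V → V → Vec d)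
    (η : V → V → D) (hη : SamePartition η (fun h u => valueInit rq h (x h) u)) :
    -- the query and value functions are conditional message-passing networks
    (∀ (a b : ℕ) (S : StructNet R d a b), ∃ C : CMPNN R d a b, C.depth = S.depth ∧
      ∀ (G' : KnowledgeGraph V R) (r : Vec d) (z : V → Vec a), C.run G' r z = S.run G' r z) ∧
    -- target node distinguishability of the initializations
    TargetNodeDistinguishable η ∧
    TargetNodeDistinguishable (fun h u => valueInit rq h (x h) u) ∧
    (∀ h u v, u ≠ v → Tendsto (fun k : ℕ => gaussianFeatures V k
      {ε | queryInit (x h) ε u = queryInit (x h) ε v}) atTop (𝓝 0)) ∧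
    (∀ h, Tendsto (fun k : ℕ => gaussianFeatures V k
      {ε | ∀ v, h ≠ v → queryInit (x h) ε h ≠ queryInit (x h) ε v}) atTop (𝓝 1)) ∧
    -- the value function is as expressive as the test
    (∀ (b : ℕ) (S : StructNet R d (d + d) b),
      Refines (rawl G η S.depth) (fun h => S.run G rq (valueInit rq h (x h)))) ∧
    (∀ T b : ℕ, 0 < b → ∃ S : StructNet R d (d + d) b, S.depth = T + 1 ∧
      SamePartition (fun h => S.run G rq (valueInit rq h (x h))) (rawl G η T)) ∧
    -- the query function is as expressive as the test started from its own initialization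
    (∀ (k b : ℕ) (ε : V → V → Vec k) (S : StructNet R d (d + k) b),
      Refines (rawl G (fun h => queryInit (x h) (ε h)) S.depth)
        (fun h => S.run G rq (queryInit (x h) (ε h)))) ∧
    (∀ (k T b : ℕ) (ε : V → V → Vec k), 0 < b → ∃ S : StructNet R d (d + k) b,
      S.depth = T + 1 ∧
      SamePartition (fun h => S.run G rq (queryInit (x h) (ε h)))
        (rawl G (fun h => queryInit (x h) (ε h)) T)) ∧
    -- injectivity of the attention update, for countable spaces and with feed-forward networks
    (∀ (m p N : ℕ) (Z : Set (Vec m)), 0 < p → Z.Countable →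
      ∃ (f : Vec m → Vec p) (ζ : ℝ), InjectiveUpdateOn (multisetUpdate id f ζ) Z N ∧
        ∀ S : Finset (Vec m), (S : Set (Vec m)) ⊆ Z → ∃ (F : FFN m p) (g : FFN p p),
          (∀ z ∈ S, F.eval z = f z) ∧
          InjectiveUpdateOn (multisetUpdate g.eval F.eval ζ) (S : Set (Vec m)) N) ∧
    (∀ (k m : ℕ) (Q : ScoreParams R d k) (S : StructNet R d (d + d) m) (ε : V → V → Vec k),
      ∃ (F g : FFN m m) (ζ : ℝ),
        SamePartition
          (fun h u => multisetUpdate g.eval F.eval ζ (S.run G rq (valueInit rq h (x h)) u)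
            (Q.weighted G rq (x h) (ε h) (S.run G rq (valueInit rq h (x h))) u))
          (fun h u => (S.run G rq (valueInit rq h (x h)) u,
            Q.weighted G rq (x h) (ε h) (S.run G rq (valueInit rq h (x h))) u))) ∧
    -- the attention layer is as expressive as the test: parameters that work for all
    -- values of the random features
    (∀ k T : ℕ, ∃ (Q : ScoreParams R d k) (P : OutParams R d), P.value.depth = T + 1 ∧
      ∀ ε : V → V → Vec k,
        SamePartition (fun h => attentionLayer Q P G δ rq h (x h) (ε h)) (rawl G η T)) ∧
    -- and the same for every prescribed query function and every value of the random features
    (∀ (k T : ℕ) (Q : ScoreParams R d k) (ε : V → V → Vec k),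
      ∃ P : OutParams R d, P.value.depth = T + 1 ∧
        SamePartition (fun h => attentionLayer Q P G δ rq h (x h) (ε h)) (rawl G η T)) := by
  obtain ⟨hη₁, hη₂⟩ := samePartition_iff_refines.1 hη
  have htarget := targetNodeDistinguishable_valueInit hrq x
  refine ⟨fun a b S => ⟨S.toCMPNN, S.depth_toCMPNN, fun G' r z => S.run_toCMPNN G' r z⟩,
    fun u v huv e => htarget u v huv (hη₁ _ _ _ _ e), htarget,
    fun h u v huv => ?_, fun h => ?_,
    fun b S => S.refines_run G rq η _ hη₁ S.depth rfl,
    fun T b hb => StructNet.exists_samePartition G rq hη₂ T b hb,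
    fun k b ε S => S.refines_run G rq _ _ (fun _ _ _ _ e => e) S.depth rfl,
    fun k T b ε hb => StructNet.exists_samePartition G rq (fun _ _ _ _ e => e) T b hb,
    fun m p N Z hp hZ => exists_injectiveUpdateOn hp hZ,
    fun k m Q S ε => exists_ffn_update_samePartition _ _ (Fintype.card V)
      fun h u => Multiset.card_map _ _,
    fun k T => ?_,
    fun k T Q ε => exists_attentionLayer_samePartition hd hδ G rq x η hη₂ T Q ε⟩
  · exact tendsto_const_nhds.congr' ((eventually_gt_atTop 0).mono fun k hk =>
      (queryInit_eq_null (x h) hk huv).symm)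
  · exact tendsto_const_nhds.congr' ((eventually_gt_atTop 0).mono fun k hk =>
      (queryInit_ne_full (x h) hk h).symm)
  · obtain ⟨P, hP, hsame⟩ := exists_attentionLayer_samePartition hd hδ G rq x η hη₂ T
      (ScoreParams.uniform R d k) (fun _ _ => 0)
    refine ⟨ScoreParams.uniform R d k, P, hP, fun ε => ?_⟩
    rwa [funext fun h => attentionLayer_uniform P G δ rq h (x h) (ε h) fun _ => 0]
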